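/- Let $G=(V,E)$ be a finite acyclic directed graph, multiple channels (edges) between two nodes being allowed, with a single source $s$ and a set $T=\{t_1,\dots,t_l\}$ of $l\ge 1$ sink nodes. Let $\mathcal F$ be a finite field and let $w$ be the information rate. In random linear network coding, $w$ imaginary channels enter $s$ whose global encoding kernels are the standard basis column vectors of $\mathcal F^w$, and every channel $e\in E$ has the global encoding kernel $f_e=\sum_{d\in In(tail(e))}k_{d,e}f_d\in\mathcal F^w$, where the local encoding coefficients $k_{d,e}$, one for each adjacent pair of channels $(d,e)$, are independent and uniformly distributed on $\mathcal F$. For a sink $t$ let $F_t=(f_e: e\in In(t))$, a $w\times|In(t)|$ matrix, and let $$P_e=\Pr(\exists\, t\in T:\ \operatorname{Rank}(F_t)<w)$$ be the failure probability. Assume that the minimum cut capacity between $s$ and each $t_i$ is at least $w$, and for each $i$ choose arbitrarily $w$ channel disjoint paths from $s$ to $t_i$; let $r_i$ be the number of internal nodes on these paths, i.e. of distinct nodes on them other than $s$ and $t_i$. Put $$a=1-\prod_{h=1}^{w}\left(1-\frac1{|\mathcal F|^h}\right),$$ and write $\sum_{i=1}^l r_i=lb+u$ with integers $b\ge 0$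 and $0\le u\le l-1$. If $b=0$ or $la\le 1$, then $$P_e\le 1-(1-a)^l(1-la)^b(1-ua).$$ -/

import Mathlib

/-- A finite acyclic directed multigraph with node set `V`, channel set `E` and a single
source node.  Parallel channels are allowed. -/
structure Network (V E : Type*) where
  /-- the node a channel leaves -/
  tail : E → V
  /-- the node a channel enters -/
  head : E → V
  /-- the source node -/
  source : V
  /-- there is no directed cycle -/
  acyclic : ∀ v : V, ¬ Relation.TransGen (fun x y => ∃ e : E, tail e = x ∧ head e = y) v v

namespace Network

variable {V E : Type*}

/-- Channel `d` feeds channel `e`: the head of `d` is the tail of `e`. -/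
def Feeds (N : Network V E) (d e : E) : Prop := N.head d = N.tail e

theorem feeds_wellFounded [Finite E] (N : Network V E) : WellFounded N.Feeds := by
  have key : ∀ d e : E, Relation.TransGen N.Feeds d e →
      Relation.TransGen (fun x y => ∃ c : E, N.tail c = x ∧ N.head c = y)
        (N.tail d) (N.tail e) := by
    intro d e h
    induction h with
    | single h => exact .single ⟨d, rfl, h⟩
    | tail _ h ih => exact .tail ih ⟨_, rfl, h⟩
  have irr : Std.Irrefl (Relation.TransGen N.Feeds) := ⟨fun e h => N.acyclic _ (key e e h)⟩
  have wf : WellFounded (Relation.TransGen N.Feeds) :=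
    Finite.wellFounded_of_trans_of_irrefl _
  exact Subrelation.wf (fun h => Relation.TransGen.single h) wf

/-- The head of a channel, where the `w` imaginary channels `Sum.inl j` (carrying the source
symbols) enter the source. -/
def extHead (N : Network V E) (w : ℕ) : Fin w ⊕ E → V
  | Sum.inl _ => N.source
  | Sum.inr e => N.head e

/-- The incoming channels of a node, including the `w` imaginary channels at the source. -/
abbrev ExtIn (N : Network V E) (w : ℕ) (v : V) : Type _ :=
  {d : Fin w ⊕ E // N.extHead w d = v}

/-- A choice of all the local encoding coefficients `k_{d,e}`, one for every adjacent pair of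
channels `(d, e)`. -/
abbrev LocalCoeffs (N : Network V E) (w : ℕ) (F : Type*) : Type _ :=
  (e : E) → N.ExtIn w (N.tail e) → F

/-- The global encoding kernels `f_e`, determined by `f_e = ∑_{d ∈ In(tail e)} k_{d,e} f_d`,
where the imaginary channels have the standard basis vectors as kernels. -/
noncomputable def globalKernel [Fintype E] [DecidableEq V] (N : Network V E) (w : ℕ)
    {F : Type*} [Field F] (k : N.LocalCoeffs w F) : E → (Fin w → F) :=
  N.feeds_wellFounded.fix fun e f =>
    ∑ d : N.ExtIn w (N.tail e), k e d •
      (match d with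
        | ⟨Sum.inl j, _⟩ => Pi.single j 1
        | ⟨Sum.inr d, h⟩ => f d h)

/-- The kernel of a channel, imaginary channels included. -/
noncomputable def extKernel [Fintype E] [DecidableEq V] (N : Network V E) (w : ℕ)
    {F : Type*} [Field F] (k : N.LocalCoeffs w F) : Fin w ⊕ E → (Fin w → F)
  | Sum.inl j => Pi.single j 1
  | Sum.inr d => N.globalKernel w k d

theorem globalKernel_eq [Fintype E] [DecidableEq V] (N : Network V E) (w : ℕ)
    {F : Type*} [Field F] (k : N.LocalCoeffs w F) (e : E) :
    N.globalKernel w k e =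
      ∑ d : N.ExtIn w (N.tail e), k e d • N.extKernel w k d.1 := by
  rw [globalKernel, WellFounded.fix_eq]
  refine Finset.sum_congr rfl fun d _ => ?_
  rcases d with ⟨j | d, h⟩ <;> rfl

/-- The decoding matrix `F_t = (f_e : e ∈ In(t))` of a node `t`. -/
noncomputable def decodingMatrix [Fintype E] [DecidableEq V] (N : Network V E) (w : ℕ)
    {F : Type*} [Field F] (k : N.LocalCoeffs w F) (t : V) :
    Matrix (Fin w) {e : E // N.head e = t} F :=
  Matrix.of fun i e => N.globalKernel w k e.1 i

/-- The failure probability `P_e = Pr(∃ t ∈ T, rank F_t < w)` of random linear network coding.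
The coefficients are independent and uniform on the finite field `F`, so their joint
distribution is uniform on the finite set of all choices. -/
noncomputable def failureProb [Fintype E] [DecidableEq V] (N : Network V E) (T : Finset V)
    (w : ℕ) (F : Type*) [Field F] : ℝ :=
  (Nat.card {k : N.LocalCoeffs w F // ∃ t ∈ T, (N.decodingMatrix w k t).rank < w} : ℝ) /
    (Nat.card (N.LocalCoeffs w F) : ℝ)

/-- The list of channels `p = [e_1, …, e_m]` is a directed path from `x` to `y`, with
`m ≥ 1`.  (Nodes cannot repeat, since the network is acyclic.) -/
def IsPath (N : Network V E) (x y : V) (p : List E) : Prop :=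
  p.head?.map N.tail = some x ∧ p.getLast?.map N.head = some y ∧ p.IsChain N.Feeds

/-- A collection of `w` channel disjoint paths from the source to the node `t`. -/
structure DisjointPaths (N : Network V E) (w : ℕ) (t : V) where
  /-- the `j`-th path -/
  path : Fin w → List E
  isPath : ∀ j, N.IsPath N.source t (path j)
  disjoint : ∀ i j, i ≠ j → (path i).Disjoint (path j)

/-- The internal nodes of a collection of paths from the source to `t`: the nodes on these
paths other than the source and `t`. -/
def DisjointPaths.internalNodes {N : Network V E} {w : ℕ} {t : V}
    (P : N.DisjointPaths w t) : Set V :=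
  {v | v ≠ N.source ∧ v ≠ t ∧ ∃ j, ∃ e ∈ P.path j, N.tail e = v ∨ N.head e = v}

end Network

/-- `a = 1 - ∏_{h=1}^{w} (1 - 1 / q^h)`. -/
noncomputable def singularProb (q w : ℕ) : ℝ :=
  1 - ∏ h ∈ Finset.Icc 1 w, (1 - 1 / (q : ℝ) ^ h)

/-! Channels are revealed one at a time in a topological order. For each sink, `Decodable` keeps a
frontier `Z` of `w` processed channels with independent kernels, from which the unprocessed path
channels still carry a flow to the sink. Initially `Z` is the set of imaginary channels; at the end
all of `Z` enters the sink, which then has full rank. If a path channel leaves a node that has `n`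
path channels of that sink still to process, the coefficient vectors that break the invariant form a
subspace of codimension `n` (`Decodable.exists_submodule`), so a single sink passes the whole node
with probability at least `∏ (1 - 1/q^h) ≥ 1 - a`.

For several sinks, single out for each one a last node, which its paths leave only by channels into
the sink (`exists_last_node`). A channel has one head, so it plays this last role for at most one
sink. Avoiding one subspace does not raise the density of another (`Submodule.le_card_avoiding`), so
that sink contributes an independent-looking factor, while the others are handled by a union bound.
The last nodes thus yield `(1 - a)^l`, and any node `v` yields `1 - c v * a`, where `c v` counts the
sinks using `v` other than as their last node. `potential` is the product of these bounds for the
unprocessed part, and `potential_le_insert` matches its change with the conditional success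
probability of one channel.

The path channels of sink `i` leave `r_i + 1` nodes (the source included); discarding the last node
leaves `r_i`. Hence `∑ c v = l * b + u` with `c v ≤ l`, and `∏ (1 - c v * a)` is least when the
counts are concentrated, which is `pow_mul_le_prod_one_sub`. -/

open Finset

/-! ### The products of `1 - 1/q^h`. -/

/-- The probability that a uniformly random `n × n` matrix over a field with `q` elements is
invertible. -/
noncomputable def invertibleProb (q n : ℕ) : ℝ :=
  ∏ h ∈ Finset.Icc 1 n, (1 - 1 / (q : ℝ) ^ h)

theorem invertibleProb_zero (q : ℕ) : invertibleProb q 0 = 1 := by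
  simp [invertibleProb]

theorem invertibleProb_succ (q n : ℕ) :
    invertibleProb q (n + 1) = invertibleProb q n * (1 - 1 / (q : ℝ) ^ (n + 1)) := by
  rw [invertibleProb, Finset.prod_Icc_succ_top (by omega), invertibleProb]

theorem one_div_pow_le_one {q : ℕ} (hq : 1 ≤ q) (n : ℕ) : 1 / (q : ℝ) ^ n ≤ 1 := by
  have : (1 : ℝ) ≤ (q : ℝ) ^ n := one_le_pow₀ (by exact_mod_cast hq)
  rw [div_le_one (by linarith)]
  exact this

theorem invertibleProb_nonneg {q : ℕ} (hq : 1 ≤ q) (n : ℕ) : 0 ≤ invertibleProb q n :=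
  Finset.prod_nonneg fun h _ => by linarith [one_div_pow_le_one hq h]

theorem invertibleProb_antitone {q : ℕ} (hq : 1 ≤ q) : Antitone (invertibleProb q) := by
  refine antitone_nat_of_succ_le fun n => ?_
  rw [invertibleProb_succ]
  have h : 0 ≤ 1 / (q : ℝ) ^ (n + 1) := by positivity
  exact mul_le_of_le_one_right (invertibleProb_nonneg hq n) (by linarith)

theorem invertibleProb_le_one {q : ℕ} (hq : 1 ≤ q) (n : ℕ) : invertibleProb q n ≤ 1 := by
  rw [← invertibleProb_zero q]
  exact invertibleProb_antitone hq (Nat.zero_le n)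

/-! ### Counting in finite modules and in product spaces. -/

/-- Submodules of a finite module are positively correlated. -/
theorem Submodule.card_mul_card_le {R M : Type*} [Ring R] [AddCommGroup M] [Module R M]
    [Finite M] (A B : Submodule R M) :
    Nat.card A * Nat.card B ≤ Nat.card (A ⊓ B : Submodule R M) * Nat.card M := by
  -- The kernel of addition `A × B → M` is a copy of `A ⊓ B`, and its range has at most `|M|`
  -- elements.
  let f : A × B →+ M := (A.subtype.coprod B.subtype).toAddMonoidHom
  have hf : ∀ x, f x = x.1 + x.2 := fun x => by simp [f]
  have h1 : Nat.card f.ker * Nat.card f.range = Nat.card (A × B) := by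
    rw [mul_comm, ← AddSubgroup.index_ker, mul_comm, AddSubgroup.card_mul_index]
  have h2 : Nat.card f.range ≤ Nat.card M := Nat.card_le_card_of_injective _ Subtype.val_injective
  have h3 : Nat.card f.ker ≤ Nat.card (A ⊓ B : Submodule R M) := by
    refine Nat.card_le_card_of_injective
      (fun x => ⟨x.1.1, x.1.1.2, ?_⟩) ?_
    · have hx : (x.1.1 : M) + x.1.2 = 0 := by rw [← hf]; exact x.2
      rw [eq_neg_of_add_eq_zero_left hx]
      exact B.neg_mem x.1.2.2
    · intro x y hxy
      have h : (x.1.1 : M) = y.1.1 :=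
        congrArg (fun z : (A ⊓ B : Submodule R M) => (z : M)) hxy
      have hx : (x.1.1 : M) + x.1.2 = 0 := by rw [← hf]; exact x.2
      have hy : (y.1.1 : M) + y.1.2 = 0 := by rw [← hf]; exact y.2
      ext
      · exact h
      · rw [h, ← hy] at hx
        exact add_left_cancel hx
  rw [← Nat.card_prod, ← h1]
  exact Nat.mul_le_mul h3 h2

/-- A lower bound for the number of vectors that avoid several subspaces, where at most one of
the subspaces contributes a separate factor. -/
theorem Submodule.le_card_avoiding {R M ι : Type*} [Ring R] [AddCommGroup M] [Module R M]
    [Finite M] (B : ι → Submodule R M) (s₁ s₂ : Finset ι) (hs : s₁.card ≤ 1) :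
    (∏ i ∈ s₁, (1 - (Nat.card (B i) : ℝ) / Nat.card M)) *
      (1 - ∑ i ∈ s₂, (Nat.card (B i) : ℝ) / Nat.card M) * Nat.card M ≤
    Nat.card {y : M // (∀ i ∈ s₁, y ∉ B i) ∧ ∀ i ∈ s₂, y ∉ B i} := by
  classical
  have := Fintype.ofFinite M
  have hM : (0 : ℝ) < Nat.card M := by exact_mod_cast Nat.card_pos
  set X : Finset M := {y | ∀ i ∈ s₁, y ∉ B i} with hX
  have hBc : ∀ i, Nat.card (B i) = #{y : M | y ∈ B i} := fun i => by
    rw [Nat.card_eq_fintype_card, Fintype.card_subtype]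
  -- Inside `X` no `B j` is denser than in `M`. As `s₁` has at most one element, `X` is all of `M`
  -- or the complement of a single submodule, so pairwise positive correlation suffices.
  have key : (#X : ℝ) = (∏ i ∈ s₁, (1 - (Nat.card (B i) : ℝ) / Nat.card M)) * Nat.card M ∧
      ∀ j, (#{y ∈ X | y ∈ B j} : ℝ) ≤ Nat.card (B j) / Nat.card M * #X := by
    rcases Nat.le_one_iff_eq_zero_or_eq_one.1 hs with h0 | h1
    · obtain rfl := Finset.card_eq_zero.1 h0
      have hXu : X = univ := by simp [hX]
      rw [hXu, Finset.card_univ, ← Nat.card_eq_fintype_card]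
      refine ⟨by simp, fun j => ?_⟩
      rw [← hBc, div_mul_cancel₀ _ hM.ne']
    · obtain ⟨i, rfl⟩ := Finset.card_eq_one.1 h1
      have hXc : #{y : M | y ∈ B i} + #X = Nat.card M := by
        rw [Nat.card_eq_fintype_card, ← Finset.card_univ,
          ← Finset.card_filter_add_card_filter_not (s := univ) (fun y => y ∈ B i)]
        simp [hX]
      have hXr : (#X : ℝ) = Nat.card M - Nat.card (B i) := by
        rw [hBc, ← hXc]; push_cast; ring
      refine ⟨?_, fun j => ?_⟩
      · rw [hXr, Finset.prod_singleton]; field_simp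
      · have h1 : #{y ∈ X | y ∈ B j} + Nat.card (B j ⊓ B i : Submodule R M) =
            Nat.card (B j) := by
          rw [hBc j, Nat.card_eq_fintype_card, Fintype.card_subtype,
            ← Finset.card_filter_add_card_filter_not (s := {y : M | y ∈ B j}) (fun y => y ∉ B i)]
          congr 2
          · ext y; simp [hX, and_comm]
          · ext y; simp
        have h2 : (Nat.card (B j) * Nat.card (B i) : ℝ) ≤
            Nat.card (B j ⊓ B i : Submodule R M) * Nat.card M := by
          exact_mod_cast Submodule.card_mul_card_le (B j) (B i)
        have h1' : (#{y ∈ X | y ∈ B j} : ℝ) + Nat.card (B j ⊓ B i : Submodule R M) =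
            Nat.card (B j) := by exact_mod_cast h1
        rw [hXr, div_mul_eq_mul_div, le_div_iff₀ hM]
        nlinarith
  obtain ⟨k1, k2⟩ := key
  rw [mul_right_comm, ← k1]
  have hcount : #X ≤ Nat.card {y : M // (∀ i ∈ s₁, y ∉ B i) ∧ ∀ i ∈ s₂, y ∉ B i} +
      ∑ i ∈ s₂, #{y ∈ X | y ∈ B i} := by
    rw [Nat.card_eq_fintype_card, Fintype.card_subtype]
    calc #X ≤ #(({y : M | (∀ i ∈ s₁, y ∉ B i) ∧ ∀ i ∈ s₂, y ∉ B i} : Finset M) ∪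
            s₂.biUnion fun i => {y ∈ X | y ∈ B i}) := by
          refine Finset.card_le_card fun y hy => ?_
          simp only [hX, mem_filter, mem_univ, true_and, mem_union, mem_biUnion] at hy ⊢
          by_cases h : ∀ i ∈ s₂, y ∉ B i
          · exact Or.inl ⟨hy, h⟩
          · push Not at h
            obtain ⟨i, hi, hyi⟩ := h
            exact Or.inr ⟨i, hi, hy, hyi⟩
      _ ≤ _ := (Finset.card_union_le _ _).trans (Nat.add_le_add_left Finset.card_biUnion_le _)
  have hcount' : (#X : ℝ) ≤ Nat.card {y : M // (∀ i ∈ s₁, y ∉ B i) ∧ ∀ i ∈ s₂, y ∉ B i} +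
      ∑ i ∈ s₂, (#{y ∈ X | y ∈ B i} : ℝ) := by exact_mod_cast hcount
  have hsum : ∑ i ∈ s₂, (#{y ∈ X | y ∈ B i} : ℝ) ≤
      (∑ i ∈ s₂, (Nat.card (B i) : ℝ) / Nat.card M) * #X := by
    rw [Finset.sum_mul]
    exact Finset.sum_le_sum fun i _ => k2 i
  linarith

/-- Resampling one coordinate: a bound on conditional frequencies gives one on frequencies. -/
theorem mul_card_le_card_of_update {ι : Type*} [DecidableEq ι] [Finite ι] {Ω : ι → Type*}
    [∀ i, Finite (Ω i)] [∀ i, Nonempty (Ω i)] (A B : (∀ i, Ω i) → Prop) (e : ι) (c : ℝ)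
    (h : ∀ k, A k → c * Nat.card (Ω e) ≤ Nat.card {y // B (Function.update k e y)}) :
    c * Nat.card {k // A k} ≤ Nat.card {k // B k} := by
  classical
  have := Fintype.ofFinite ι
  have := fun i => Fintype.ofFinite (Ω i)
  have hpos : (0 : ℝ) < Nat.card (Ω e) := by exact_mod_cast Nat.card_pos
  -- Keeping the overwritten coordinate next to the updated family makes resampling injective.
  let f : (Σ k : {k // A k}, {y // B (Function.update k.1 e y)}) → {k // B k} × Ω e :=
    fun x => (⟨Function.update x.1.1 e x.2.1, x.2.2⟩, x.1.1 e)
  have hf : Function.Injective f := by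
    rintro ⟨⟨k, hk⟩, y, hy⟩ ⟨⟨k', hk'⟩, y', hy'⟩ hxy
    simp only [f, Prod.mk.injEq, Subtype.mk.injEq] at hxy
    obtain ⟨h1, h2⟩ := hxy
    have hkk : k = k' := by
      funext i
      by_cases hi : i = e
      · subst hi; exact h2
      · have := congrFun h1 i
        simpa [hi] using this
    subst hkk
    have : y = y' := by simpa using congrFun h1 e
    subst this
    rfl
  have hcard := Nat.card_le_card_of_injective f hf
  rw [Nat.card_prod, Nat.card_sigma] at hcard
  have hcard' : (∑ k : {k // A k}, (Nat.card {y // B (Function.update k.1 e y)} : ℝ)) ≤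
      Nat.card {k // B k} * Nat.card (Ω e) := by exact_mod_cast hcard
  have hsum : ∑ _k : {k // A k}, c * Nat.card (Ω e) ≤
      ∑ k : {k // A k}, (Nat.card {y // B (Function.update k.1 e y)} : ℝ) :=
    Finset.sum_le_sum fun k _ => h k.1 k.2
  rw [Finset.sum_const, Finset.card_univ, ← Nat.card_eq_fintype_card, nsmul_eq_mul] at hsum
  nlinarith

/-! ### Inequalities for products of `1 - x`. -/

theorem one_sub_sum_mul_le_prod {ι : Type*} (s : Finset ι) (x : ι → ℝ) (hx : ∀ i ∈ s, 0 ≤ x i)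
    (hs : ∑ i ∈ s, x i ≤ 1) : 1 - ∑ i ∈ s, x i ≤ ∏ i ∈ s, (1 - x i) := by
  classical
  induction s using Finset.induction_on with
  | empty => simp
  | insert i s hi ih =>
    rw [Finset.sum_insert hi] at hs ⊢
    rw [Finset.prod_insert hi]
    have h0 := hx i (mem_insert_self i s)
    have h1 := Finset.sum_nonneg fun j hj => hx j (mem_insert_of_mem hj)
    have := ih (fun j hj => hx j (mem_insert_of_mem hj)) (by linarith)
    nlinarith

/-- Among the distributions of a total over cells of capacity `l`, the product of the `1 - x a`
is least when as many cells as possible are full. -/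
theorem pow_mul_le_prod_one_sub {ι : Type*} (s : Finset ι) (x : ι → ℕ) {l : ℕ} (hl : 0 < l)
    {a : ℝ} (ha : 0 ≤ a) (hla : (l : ℝ) * a ≤ 1) (hx : ∀ i ∈ s, x i ≤ l) :
    (1 - (l : ℝ) * a) ^ ((∑ i ∈ s, x i) / l) * (1 - ((∑ i ∈ s, x i) % l : ℕ) * a) ≤
      ∏ i ∈ s, (1 - (x i : ℝ) * a) := by
  classical
  induction s using Finset.induction_on with
  | empty => simp
  | insert i s hi ih =>
    rw [Finset.sum_insert hi, Finset.prod_insert hi]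
    have hxi := hx i (mem_insert_self i s)
    have ih := ih fun j hj => hx j (mem_insert_of_mem hj)
    set n := ∑ j ∈ s, x j
    have hr : n % l < l := Nat.mod_lt _ hl
    have hn := Nat.div_add_mod n l
    set r := n % l
    set b := n / l
    have hxr : (x i : ℝ) ≤ l := by exact_mod_cast hxi
    have hrr : (r : ℝ) ≤ l := by exact_mod_cast hr.le
    have hp : 0 ≤ (1 - (l : ℝ) * a) ^ b := pow_nonneg (by linarith) _
    have hxa : 0 ≤ 1 - (x i : ℝ) * a := by nlinarith
    refine le_trans ?_ (mul_le_mul_of_nonneg_left ih hxa)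
    -- The new cell is merged into the partial one. Without overflow the loss is `x r a²`; with
    -- overflow the two cells become `l` and `m = r + x - l`, and the loss is `(l - r)(l - x) a²`.
    by_cases hlt : r + x i < l
    · have h1 : (x i + n) / l = b := by
        rw [← hn, show x i + (l * b + r) = (r + x i) + l * b by ring,
          Nat.add_mul_div_left _ _ hl, Nat.div_eq_of_lt hlt, zero_add]
      have h2 : (x i + n) % l = r + x i := by
        rw [← hn, show x i + (l * b + r) = (r + x i) + l * b by ring,
          Nat.add_mul_mod_self_left, Nat.mod_eq_of_lt hlt]
      rw [h1, h2]
      push_cast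
      have h3 : 0 ≤ (x i : ℝ) * r * a ^ 2 := by positivity
      nlinarith [mul_nonneg hp h3]
    · obtain ⟨m, hm⟩ : ∃ m, r + x i = l + m := ⟨r + x i - l, by omega⟩
      have hml : m < l := by omega
      have h1 : (x i + n) / l = b + 1 := by
        rw [← hn, show x i + (l * b + r) = m + l * (b + 1) by rw [mul_add]; omega,
          Nat.add_mul_div_left _ _ hl, Nat.div_eq_of_lt hml, zero_add]
      have h2 : (x i + n) % l = m := by
        rw [← hn, show x i + (l * b + r) = m + l * (b + 1) by rw [mul_add]; omega,
          Nat.add_mul_mod_self_left, Nat.mod_eq_of_lt hml]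
      rw [h1, h2, pow_succ]
      have hmr : (m : ℝ) = r + x i - l := by
        have : (r : ℝ) + x i = l + m := by exact_mod_cast hm
        linarith
      have h3 : 0 ≤ ((l : ℝ) - r) * (l - x i) * a ^ 2 :=
        mul_nonneg (mul_nonneg (by linarith) (by linarith)) (by positivity)
      rw [hmr]
      nlinarith [mul_nonneg hp h3]

/-! ### Paths in an acyclic network and the flow they carry. -/

namespace Network

variable {V E : Type*}

/-- The node `x` has a channel to the node `y`. -/
def Link (N : Network V E) (x y : V) : Prop := ∃ e : E, N.tail e = x ∧ N.head e = y

theorem transGen_link_of_feeds (N : Network V E) {d e : E} (h : Relation.TransGen N.Feeds d e) :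
    Relation.TransGen N.Link (N.tail d) (N.tail e) := by
  induction h with
  | single h => exact .single ⟨_, rfl, h⟩
  | tail _ h ih => exact .tail ih ⟨_, rfl, h⟩

theorem tail_ne_head (N : Network V E) (e : E) : N.tail e ≠ N.head e :=
  fun h => N.acyclic (N.tail e) (.single ⟨e, rfl, h.symm⟩)

theorem isPath_singleton (N : Network V E) {x y : V} {e : E} :
    N.IsPath x y [e] ↔ N.tail e = x ∧ N.head e = y := by
  simp [IsPath]

theorem isPath_cons_cons (N : Network V E) {x y : V} {d e : E} {p : List E} :
    N.IsPath x y (d :: e :: p) ↔ N.tail d = x ∧ N.IsPath (N.head d) y (e :: p) := by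
  simp [IsPath, Feeds]
  grind

theorem not_isPath_nil (N : Network V E) {x y : V} : ¬ N.IsPath x y [] := by
  simp [IsPath]

theorem IsPath.transGen_link {N : Network V E} {y : V} :
    ∀ {p : List E} {x : V}, N.IsPath x y p → ∀ e ∈ p, Relation.TransGen N.Link (N.tail e) y
  | [], _, h => (N.not_isPath_nil h).elim
  | [d], _, h => by
    rw [isPath_singleton] at h
    intro e he
    rw [List.mem_singleton] at he
    subst he
    exact .single ⟨e, rfl, h.2⟩
  | d :: e :: p, _, h => by
    rw [isPath_cons_cons] at h
    intro c hc
    rcases List.mem_cons.1 hc with rfl | hc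
    · have h1 := h.2.transGen_link e (by simp)
      have h2 : N.tail e = N.head c := by
        have := h.2.1
        simpa using this
      rw [h2] at h1
      exact .head ⟨c, rfl, rfl⟩ h1
    · exact h.2.transGen_link c hc

theorem IsPath.ne {N : Network V E} {x y : V} {p : List E} (h : N.IsPath x y p) : x ≠ y := by
  rintro rfl
  cases p with
  | nil => exact N.not_isPath_nil h
  | cons e p =>
    have h1 := h.transGen_link e (by simp)
    have h2 : N.tail e = x := by simpa using h.1
    rw [h2] at h1
    exact N.acyclic _ h1

theorem IsPath.pairwise {N : Network V E} {x y : V} {p : List E} (h : N.IsPath x y p) :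
    p.Pairwise fun d e => N.tail d ≠ N.tail e := by
  have h1 : p.IsChain (Relation.TransGen N.Feeds) := h.2.2.imp fun _ _ h => .single h
  refine (List.isChain_iff_pairwise.1 h1).imp fun {d e} hde heq => ?_
  have := N.transGen_link_of_feeds hde
  rw [heq] at this
  exact N.acyclic _ this

theorem IsPath.nodup {N : Network V E} {x y : V} {p : List E} (h : N.IsPath x y p) : p.Nodup :=
  h.pairwise.imp fun h heq => h (congrArg _ heq)

namespace DisjointPaths

variable {N : Network V E} {w : ℕ} {t : V}

theorem source_ne (P : N.DisjointPaths w t) (hw : 0 < w) : N.source ≠ t :=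
  (P.isPath ⟨0, hw⟩).ne

variable [DecidableEq E]

/-- The channels used by a collection of paths. -/
def edges (P : N.DisjointPaths w t) : Finset E :=
  univ.biUnion fun j => (P.path j).toFinset

theorem mem_edges (P : N.DisjointPaths w t) {e : E} : e ∈ P.edges ↔ ∃ j, e ∈ P.path j := by
  simp [edges]

theorem card_filter_edges (P : N.DisjointPaths w t) (f : E → Prop) [DecidablePred f] :
    #{e ∈ P.edges | f e} = ∑ j, (P.path j).countP fun e => f e := by
  rw [edges, Finset.filter_biUnion, Finset.card_biUnion]
  · refine Finset.sum_congr rfl fun j _ => ?_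
    have h : {e ∈ (P.path j).toFinset | f e} = ((P.path j).filter fun e => f e).toFinset := by
      ext e; simp
    rw [h, List.toFinset_card_of_nodup ((P.isPath j).nodup.filter _),
      List.countP_eq_length_filter]
  · intro i _ j _ hij
    refine Finset.disjoint_filter_filter ?_
    rw [List.disjoint_toFinset_iff_disjoint]
    exact P.disjoint i j hij

theorem tail_ne (P : N.DisjointPaths w t) {e : E} (he : e ∈ P.edges) : N.tail e ≠ t := by
  obtain ⟨j, hj⟩ := P.mem_edges.1 he
  intro h
  have := (P.isPath j).transGen_link e hj
  rw [h] at this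
  exact N.acyclic _ this

end DisjointPaths

variable [DecidableEq V]

/-- Flow conservation for one path: each visit to `v` enters and leaves it, apart from the two ends.
-/
theorem IsPath.countP_head {N : Network V E} {y : V} (v : V) :
    ∀ {p : List E} {x : V}, N.IsPath x y p →
      (if x = v then 1 else 0) + p.countP (fun e => N.head e = v) =
        p.countP (fun e => N.tail e = v) + if y = v then 1 else 0
  | [], _, h => (N.not_isPath_nil h).elim
  | [d], _, h => by
    rw [isPath_singleton] at h
    obtain ⟨rfl, rfl⟩ := h
    simp [List.countP_cons]
  | d :: e :: p, _, h => by
    rw [isPath_cons_cons] at h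
    obtain ⟨rfl, h⟩ := h
    have ih := h.countP_head v
    rw [List.countP_cons, List.countP_cons (p := fun e => decide (N.tail e = v)) (a := d)]
    simp only [decide_eq_true_eq]
    omega

theorem IsPath.countP_tail_le_one {N : Network V E} {x y : V} {p : List E} (h : N.IsPath x y p)
    (v : V) : p.countP (fun e => N.tail e = v) ≤ 1 := by
  rw [List.countP_eq_length_filter]
  by_contra! hlt
  have hp := h.pairwise.filter (fun e => decide (N.tail e = v))
  have hm : ∀ e ∈ p.filter (fun e => decide (N.tail e = v)), N.tail e = v := by simp
  generalize p.filter (fun e => decide (N.tail e = v)) = q at hlt hp hm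
  match q, hlt with
  | c :: d :: q, _ =>
    rw [List.pairwise_cons] at hp
    exact hp.1 d (by simp) ((hm c (by simp)).trans (hm d (by simp)).symm)

namespace DisjointPaths

variable [DecidableEq E] {N : Network V E} {w : ℕ} {t : V}

theorem conservation (P : N.DisjointPaths w t) (v : V) :
    (if N.source = v then w else 0) + #{e ∈ P.edges | N.head e = v} =
      #{e ∈ P.edges | N.tail e = v} + if t = v then w else 0 := by
  rw [card_filter_edges, card_filter_edges]
  have := Finset.sum_congr (rfl : (univ : Finset (Fin w)) = univ)
    fun j _ => (P.isPath j).countP_head v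
  rw [Finset.sum_add_distrib, Finset.sum_add_distrib] at this
  simpa using this

theorem card_tail_le (P : N.DisjointPaths w t) (v : V) :
    #{e ∈ P.edges | N.tail e = v} ≤ w := by
  rw [card_filter_edges]
  calc _ ≤ ∑ _j : Fin w, 1 := Finset.sum_le_sum fun j _ => (P.isPath j).countP_tail_le_one v
    _ = w := by simp

theorem head_mem_image_tail (P : N.DisjointPaths w t) {e : E} (he : e ∈ P.edges)
    (hne : N.head e ≠ t) : N.head e ∈ P.edges.image N.tail := by
  have h := P.conservation (N.head e)
  rw [if_neg hne.symm] at h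
  have h1 : 0 < #{c ∈ P.edges | N.head c = N.head e} :=
    Finset.card_pos.2 ⟨e, by simp [he]⟩
  obtain ⟨c, hc⟩ := Finset.card_pos.1 (show 0 < #{c ∈ P.edges | N.tail c = N.head e} by omega)
  rw [Finset.mem_filter] at hc
  exact Finset.mem_image.2 ⟨c, hc.1, hc.2⟩

theorem source_mem_image_tail (P : N.DisjointPaths w t) (hw : 0 < w) :
    N.source ∈ P.edges.image N.tail := by
  have h := P.conservation N.source
  rw [if_pos rfl, if_neg (P.source_ne hw).symm] at h
  obtain ⟨c, hc⟩ := Finset.card_pos.1 (show 0 < #{c ∈ P.edges | N.tail c = N.source} by omega)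
  rw [Finset.mem_filter] at hc
  exact Finset.mem_image.2 ⟨c, hc.1, hc.2⟩

/-- By conservation, a node other than `t` that is entered by a path channel is also left by one, so
tails alone account for the internal nodes. -/
theorem internalNodes_eq (P : N.DisjointPaths w t) :
    P.internalNodes = ↑((P.edges.image N.tail).erase N.source) := by
  ext v
  rw [Finset.mem_coe, Finset.mem_erase]
  constructor
  · rintro ⟨hs, ht, j, e, he, rfl | rfl⟩
    · exact ⟨hs, Finset.mem_image_of_mem _ (P.mem_edges.2 ⟨j, he⟩)⟩
    · exact ⟨hs, P.head_mem_image_tail (P.mem_edges.2 ⟨j, he⟩) ht⟩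
  · rintro ⟨hs, hv⟩
    obtain ⟨e, he, rfl⟩ := Finset.mem_image.1 hv
    obtain ⟨j, hj⟩ := P.mem_edges.1 he
    exact ⟨hs, P.tail_ne he, j, e, hj, Or.inl rfl⟩

theorem ncard_internalNodes_add_one (P : N.DisjointPaths w t) (hw : 0 < w) :
    P.internalNodes.ncard + 1 = #(P.edges.image N.tail) := by
  rw [internalNodes_eq, Set.ncard_coe_finset,
    Finset.card_erase_add_one (P.source_mem_image_tail hw)]

/-- Some node on the paths has the property that the paths leave it only towards the sink. -/
theorem exists_last_node [Finite V] (P : N.DisjointPaths w t) (hw : 0 < w) :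
    ∃ v ∈ P.edges.image N.tail, ∀ e ∈ P.edges, N.tail e = v → N.head e = t := by
  have irr : Std.Irrefl (flip (Relation.TransGen N.Link)) := ⟨fun v h => N.acyclic v h⟩
  have tr : IsTrans V (flip (Relation.TransGen N.Link)) := ⟨fun _ _ _ h h' => h'.trans h⟩
  have wf : WellFounded (flip (Relation.TransGen N.Link)) :=
    Finite.wellFounded_of_trans_of_irrefl _
  -- A most downstream tail: by acyclicity, reverse reachability is well founded on the finite node
  -- set.
  obtain ⟨v, hv, hmin⟩ := wf.has_min (↑(P.edges.image N.tail) : Set V)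
    ⟨_, P.source_mem_image_tail hw⟩
  refine ⟨v, hv, fun e he htail => ?_⟩
  by_contra hne
  exact hmin _ (P.head_mem_image_tail he hne) (.single ⟨e, htail, rfl⟩)

end DisjointPaths

end Network

/-! ### Decodability while channels are processed. -/

namespace Network

variable {V E F : Type*} [DecidableEq V] [DecidableEq E]

/-- The number of channels of `D` outside `S` that leave the node `v`. -/
def remaining (N : Network V E) (D S : Finset E) (v : V) : ℕ :=
  #{e ∈ D \ S | N.tail e = v}

theorem remaining_insert {N : Network V E} {S D : Finset E} {e : E} (he : e ∉ S) (heD : e ∈ D) :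
    N.remaining D (insert e S) (N.tail e) + 1 = N.remaining D S (N.tail e) := by
  have h : {c ∈ D \ S | N.tail c = N.tail e} =
      insert e {c ∈ D \ insert e S | N.tail c = N.tail e} := by
    ext c; simp only [mem_filter, mem_sdiff, mem_insert]; grind
  rw [remaining, remaining, h, card_insert_of_notMem (by simp)]

theorem remaining_insert_of_ne {N : Network V E} {S D : Finset E} {e : E} {v : V}
    (hv : e ∈ D → N.tail e ≠ v) : N.remaining D (insert e S) v = N.remaining D S v := by
  rw [remaining, remaining]
  congr 1
  ext c; simp only [mem_filter, mem_sdiff, mem_insert]; grind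

variable [Fintype E] [Field F]

/-- `S` is closed under predecessors, so kernels in `S` never involve the coefficients of a channel
outside it. -/
theorem globalKernel_update_of_mem {N : Network V E} {w : ℕ} {S : Finset E} {e : E}
    (hS : ∀ d ∈ S, ∀ c, N.Feeds c d → c ∈ S) (he : e ∉ S) (k : N.LocalCoeffs w F)
    (y : N.ExtIn w (N.tail e) → F) (d : E) (hd : d ∈ S) :
    N.globalKernel w (Function.update k e y) d = N.globalKernel w k d := by
  induction d using N.feeds_wellFounded.induction with
  | _ d ih =>
    have hne : d ≠ e := by rintro rfl; exact he hd
    rw [globalKernel_eq, globalKernel_eq, Function.update_of_ne hne]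
    refine Finset.sum_congr rfl fun c _ => ?_
    rcases c with ⟨j | c, hc⟩
    · rfl
    · simp only [extKernel]
      rw [ih c hc (hS d hd c hc)]

theorem globalKernel_update_self {N : Network V E} {w : ℕ} {S : Finset E} {e : E}
    (hS : ∀ d ∈ S, ∀ c, N.Feeds c d → c ∈ S) (he : e ∉ S) (hpred : ∀ c, N.Feeds c e → c ∈ S)
    (k : N.LocalCoeffs w F) (y : N.ExtIn w (N.tail e) → F) :
    N.globalKernel w (Function.update k e y) e = ∑ d, y d • N.extKernel w k d.1 := by
  rw [globalKernel_eq, Function.update_self]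
  refine Finset.sum_congr rfl fun c _ => ?_
  rcases c with ⟨j | c, hc⟩
  · rfl
  · simp only [extKernel]
    rw [globalKernel_update_of_mem hS he k y c (hpred c hc)]

/-- After the channels in `S` have been processed, there are `w` channels with linearly
independent kernels from which the remaining channels of `D` carry a unit flow to `t`. -/
def Decodable (N : Network V E) (w : ℕ) (k : N.LocalCoeffs w F) (t : V) (D S : Finset E) : Prop :=
  ∃ Z : Finset (Fin w ⊕ E), (∀ d, Sum.inr d ∈ Z → d ∈ S) ∧ #Z = w ∧
    LinearIndepOn F (N.extKernel w k) (Z : Set (Fin w ⊕ E)) ∧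
    ∀ v, v ≠ t → #{z ∈ Z | N.extHead w z = v} + #{e ∈ D \ S | N.head e = v} =
      N.remaining D S v

theorem extKernel_update {N : Network V E} {w : ℕ} {S : Finset E} {e : E}
    (hS : ∀ d ∈ S, ∀ c, N.Feeds c d → c ∈ S) (he : e ∉ S) (k : N.LocalCoeffs w F)
    (y : N.ExtIn w (N.tail e) → F) {Z : Finset (Fin w ⊕ E)} (hZ : ∀ d, Sum.inr d ∈ Z → d ∈ S) :
    Set.EqOn (N.extKernel w (Function.update k e y)) (N.extKernel w k) Z := by
  rintro (j | d) hd
  · rfl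
  · exact globalKernel_update_of_mem hS he k y d (hZ d hd)

theorem Decodable.of_notMem {N : Network V E} {w : ℕ} {S D : Finset E} {e : E} {t : V}
    (hS : ∀ d ∈ S, ∀ c, N.Feeds c d → c ∈ S) (he : e ∉ S) {k : N.LocalCoeffs w F}
    (h : N.Decodable w k t D S) (heD : e ∉ D) (y : N.ExtIn w (N.tail e) → F) :
    N.Decodable w (Function.update k e y) t D (insert e S) := by
  obtain ⟨Z, hZS, hZ, hind, hflow⟩ := h
  have hD : D \ insert e S = D \ S := by
    ext d; simp only [mem_sdiff, mem_insert]; grind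
  refine ⟨Z, fun d hd => mem_insert_of_mem (hZS d hd), hZ,
    hind.congr (extKernel_update hS he k y hZS).symm, fun v hv => ?_⟩
  rw [remaining, hD]
  exact hflow v hv

/-- The coefficients of a channel that destroy decodability form a subspace whose codimension
is the number of channels still to be processed at the node. -/
theorem Decodable.exists_submodule [Finite F] {N : Network V E} {w : ℕ} {S D : Finset E} {e : E}
    {t : V} (hS : ∀ d ∈ S, ∀ c, N.Feeds c d → c ∈ S) (he : e ∉ S)
    (hpred : ∀ c, N.Feeds c e → c ∈ S) {k : N.LocalCoeffs w F}
    (h : N.Decodable w k t D S) (heD : e ∈ D) (het : N.tail e ≠ t) :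
    ∃ B : Submodule F (N.ExtIn w (N.tail e) → F),
      Nat.card B * Nat.card F ^ N.remaining D S (N.tail e) =
        Nat.card (N.ExtIn w (N.tail e) → F) ∧
      ∀ y, y ∉ B → N.Decodable w (Function.update k e y) t D (insert e S) := by
  obtain ⟨Z, hZS, hZ, hind, hflow⟩ := h
  set f := N.extKernel w k with hf
  -- `R` is the part of the frontier that must survive: channel `e` may only replace a frontier
  -- channel entering its own tail.
  set R := {z ∈ Z | N.extHead w z ≠ N.tail e} with hR
  have hRZ : R ⊆ Z := Finset.filter_subset _ _
  have hcard : #{z ∈ Z | N.extHead w z = N.tail e} + #R = #Z :=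
    Finset.card_filter_add_card_filter_not _
  have hrem : #{z ∈ Z | N.extHead w z = N.tail e} = N.remaining D S (N.tail e) := by
    -- All channels feeding `e` are processed, so the flow into its tail comes from the frontier
    -- alone.
    rw [← hflow (N.tail e) het, Nat.left_eq_add, Finset.card_eq_zero, Finset.filter_eq_empty_iff]
    intro c hc hcv
    exact (mem_sdiff.1 hc).2 (hpred c hcv)
  have hindR : LinearIndepOn F f (R : Set (Fin w ⊕ E)) := hind.mono (by exact_mod_cast hRZ)
  set U := Submodule.span F (f '' (R : Set (Fin w ⊕ E))) with hU
  have hUrank : Module.finrank F U = #R := by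
    have := finrank_span_eq_card hindR
    rw [hU, Set.image_eq_range]
    simpa using this
  have hspan : Submodule.span F (f '' (Z : Set (Fin w ⊕ E))) = ⊤ := by
    apply Submodule.eq_top_of_finrank_eq
    have := finrank_span_eq_card hind
    rw [Set.image_eq_range, Module.finrank_fin_fun]
    simpa [hZ] using this
  let φ : (N.ExtIn w (N.tail e) → F) →ₗ[F] (Fin w → F) := Fintype.linearCombination F fun d => f d.1
  have hφ : ∀ y, φ y = ∑ d, y d • f d.1 := fun y => Fintype.linearCombination_apply _ _ _
  -- The bad vectors are those putting the new kernel into `U`, that is, `ker ψ`. Since `Z` spans,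
  -- `ψ` is onto, and its kernel has codimension `w - #R`.
  let ψ := U.mkQ ∘ₗ φ
  have hψ : LinearMap.range ψ = ⊤ := by
    rw [LinearMap.range_comp, Submodule.map_mkQ_eq_top, eq_top_iff, ← hspan, Submodule.span_le]
    rintro _ ⟨z, hz, rfl⟩
    by_cases hzv : N.extHead w z = N.tail e
    · refine Submodule.mem_sup_right ⟨Pi.single ⟨z, hzv⟩ 1, ?_⟩
      simp [φ]
    · exact Submodule.mem_sup_left (Submodule.subset_span ⟨z, by simp_all, rfl⟩)
  refine ⟨LinearMap.ker ψ, ?_, fun y hy => ?_⟩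
  · have h1 := LinearMap.finrank_range_add_finrank_ker ψ
    have h2 := U.finrank_quotient_add_finrank
    rw [hψ, finrank_top] at h1
    rw [hUrank, Module.finrank_fin_fun] at h2
    rw [Module.natCard_eq_pow_finrank (K := F) (V := N.ExtIn w (N.tail e) → F), ← h1,
      Module.natCard_eq_pow_finrank (K := F) (V := LinearMap.ker ψ), ← pow_add]
    congr 1
    omega
  · have hx : ∑ d, y d • f d.1 ∉ U := by
      intro hmem
      apply hy
      rw [LinearMap.mem_ker, LinearMap.comp_apply, hφ]
      exact (Submodule.Quotient.mk_eq_zero U).2 hmem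
    set g := N.extKernel w (Function.update k e y) with hg
    have hge : g (Sum.inr e) = ∑ d, y d • f d.1 := globalKernel_update_self hS he hpred k y
    have hgf : Set.EqOn g f Z := extKernel_update hS he k y hZS
    have hgR : g '' (R : Set (Fin w ⊕ E)) = f '' (R : Set (Fin w ⊕ E)) :=
      (hgf.mono (by exact_mod_cast hRZ)).image_eq
    have heZ : Sum.inr e ∉ Z := fun h => he (hZS e h)
    have hindR' : LinearIndepOn F g (insert (Sum.inr e) (R : Set (Fin w ⊕ E))) := by
      refine LinearIndepOn.insert (hindR.congr (hgf.mono (by exact_mod_cast hRZ)).symm) ?_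
      rw [hgR, hge]
      exact hx
    -- Steinitz exchange: completing `R` and `e` to a basis inside `Z ∪ {e}` drops exactly one
    -- channel entering the tail of `e`.
    obtain ⟨b, hbZ, hbR, hbspan, hbind⟩ := exists_linearIndepOn_extension hindR'
      (Set.insert_subset_insert (show (R : Set (Fin w ⊕ E)) ⊆ Z by exact_mod_cast hRZ))
    have hbfin : b.Finite := (Z.finite_toSet.insert _).subset hbZ
    lift b to Finset (Fin w ⊕ E) using hbfin
    have hbtop : Submodule.span F (g '' (b : Set (Fin w ⊕ E))) = ⊤ := by
      rw [eq_top_iff, ← hspan, ← hgf.image_eq, Submodule.span_le]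
      exact (Set.image_mono (Set.subset_insert _ _)).trans hbspan
    have hbcard : #b = w := by
      have := finrank_span_eq_card hbind
      rw [← Set.image_eq_range, hbtop, finrank_top, Module.finrank_fin_fun] at this
      simpa using this.symm
    have heb : Sum.inr e ∈ b := hbR (Set.mem_insert _ _)
    have hRb : ∀ z ∈ R, z ∈ b := fun z hz => hbR (Set.mem_insert_of_mem _ hz)
    have hbZ' : ∀ z ∈ b, z ≠ Sum.inr e → z ∈ Z := fun z hz hne =>
      (hbZ hz).resolve_left hne
    have hvb : #{z ∈ b | N.extHead w z = N.tail e} + 1 = #{z ∈ Z | N.extHead w z = N.tail e} := by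
      have h1 : #{z ∈ b | N.extHead w z = N.tail e} + #{z ∈ b | N.extHead w z ≠ N.tail e} = #b :=
        Finset.card_filter_add_card_filter_not _
      have h2 : {z ∈ b | N.extHead w z ≠ N.tail e} = insert (Sum.inr e) R := by
        ext z
        simp only [mem_filter, mem_insert, hR]
        constructor
        · rintro ⟨hz, hzv⟩
          by_cases hze : z = Sum.inr e
          · exact Or.inl hze
          · exact Or.inr ⟨hbZ' z hz hze, hzv⟩
        · rintro (rfl | hz)
          · exact ⟨heb, (N.tail_ne_head e).symm⟩
          · exact ⟨hRb z (by simpa [hR] using hz), hz.2⟩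
      rw [h2, Finset.card_insert_of_notMem (fun h => heZ (hRZ h))] at h1
      omega
    refine ⟨b, fun d hd => ?_, hbcard, hbind, fun u hu => ?_⟩
    · by_cases hde : d = e
      · exact hde ▸ mem_insert_self _ _
      · exact mem_insert_of_mem (hZS d (hbZ' _ hd (by simpa using hde)))
    · have hfl := hflow u hu
      have hsd : {c ∈ D \ S | N.head c = u} =
          if N.head e = u then insert e {c ∈ D \ insert e S | N.head c = u}
          else {c ∈ D \ insert e S | N.head c = u} := by
        ext c
        split_ifs <;> simp only [mem_filter, mem_sdiff, mem_insert] <;> grind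
      by_cases huv : u = N.tail e
      · subst huv
        have hne : N.head e ≠ N.tail e := (N.tail_ne_head e).symm
        rw [if_neg hne] at hsd
        rw [hsd] at hfl
        have := remaining_insert (N := N) he heD
        omega
      · rw [remaining_insert_of_ne fun _ => Ne.symm huv]
        have hbu : {z ∈ b | N.extHead w z = u} =
            if N.head e = u then insert (Sum.inr e) {z ∈ Z | N.extHead w z = u}
            else {z ∈ Z | N.extHead w z = u} := by
          have hzR : ∀ z ∈ Z, N.extHead w z = u → z ∈ b := fun z hz hzu =>
            hRb z (by simp [hR, hz, hzu, huv])
          ext z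
          split_ifs with heu
          · simp only [mem_filter, mem_insert]
            constructor
            · rintro ⟨hz, hzu⟩
              by_cases hze : z = Sum.inr e
              · exact Or.inl hze
              · exact Or.inr ⟨hbZ' z hz hze, hzu⟩
            · rintro (rfl | hz)
              · exact ⟨heb, heu⟩
              · exact ⟨hzR z hz.1 hz.2, hz.2⟩
          · simp only [mem_filter]
            constructor
            · rintro ⟨hz, hzu⟩
              refine ⟨hbZ' z hz ?_, hzu⟩
              rintro rfl
              exact heu hzu
            · rintro hz
              exact ⟨hzR z hz.1 hz.2, hz.2⟩
        rw [hbu]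
        rw [hsd] at hfl
        split_ifs with heu
        · rw [if_pos heu, card_insert_of_notMem (by simp)] at hfl
          rw [card_insert_of_notMem (by simp [heZ])]
          omega
        · rw [if_neg heu] at hfl
          exact hfl

/-- With nothing left to process, the flow condition forces all of `Z` to enter `t`; `source ≠ t`
excludes imaginary channels, so `Z` gives `w` independent columns. -/
theorem Decodable.not_rank_lt {N : Network V E} {w : ℕ} {k : N.LocalCoeffs w F} {t : V}
    {D : Finset E} (hst : N.source ≠ t) (h : N.Decodable w k t D univ) :
    ¬ (N.decodingMatrix w k t).rank < w := by
  obtain ⟨Z, -, hZ, hind, hflow⟩ := h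
  have hhead : ∀ z ∈ Z, N.extHead w z = t := by
    intro z hz
    by_contra hne
    have := hflow _ hne
    simp only [remaining, sdiff_eq_empty_iff_subset.2 (subset_univ D), filter_empty, card_empty,
      add_zero, card_eq_zero, filter_eq_empty_iff] at this
    exact this hz rfl
  rw [not_lt, Matrix.rank_eq_finrank_span_cols]
  have h1 := finrank_span_eq_card hind
  replace h1 : Module.finrank F _ = w := h1.trans (by simp [hZ])
  refine h1.symm.trans_le ?_
  refine Submodule.finrank_mono (Submodule.span_mono ?_)
  rintro _ ⟨⟨z, hz⟩, rfl⟩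
  have hzt := hhead z hz
  rcases z with j | e
  · exact absurd hzt hst
  · exact ⟨⟨e, hzt⟩, rfl⟩

theorem decodable_empty {N : Network V E} {w : ℕ} {t : V} (P : N.DisjointPaths w t)
    (k : N.LocalCoeffs w F) : N.Decodable w k t P.edges ∅ := by
  refine ⟨univ.map Function.Embedding.inl, by simp, by simp, ?_, fun v hv => ?_⟩
  · rw [coe_map, coe_univ, Set.image_univ]
    refine (linearIndepOn_range_iff Sum.inl_injective _).2 ?_
    convert (Pi.basisFun F (Fin w)).linearIndependent using 1
    ext i : 1
    simp [extKernel]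
  · have h := P.conservation v
    rw [if_neg hv.symm, add_zero] at h
    rw [remaining, sdiff_empty, ← h, filter_map, card_map]
    congr 1
    by_cases hs : N.source = v <;> simp [hs, extHead, Function.comp_def]

end Network

/-! ### The potential and its change at one channel. -/

namespace Network

section Potential

variable {V E ι : Type*} [DecidableEq V] [DecidableEq E] [Fintype ι]

/-- A union bound for the failure at the node `v` of the sinks whose last node is not `v`, once
the channels in `S` have been processed. -/
noncomputable def nodeLoss (N : Network V E) (q : ℕ) (D : ι → Finset E) (last : ι → V)
    (S : Finset E) (v : V) : ℝ :=
  ∑ i with last i ≠ v, (1 - invertibleProb q (N.remaining (D i) S v))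

/-- A lower bound for the conditional probability of success once the channels in `S` have been
processed successfully. -/
noncomputable def potential [Fintype V] (N : Network V E) (q : ℕ) (D : ι → Finset E)
    (last : ι → V) (S : Finset E) : ℝ :=
  (∏ i, invertibleProb q (N.remaining (D i) S (last i))) * ∏ v, (1 - N.nodeLoss q D last S v)

/-- Per sink, the loss splits as `x + y - x y`, with `x` the loss at `e` and `y` the later loss. The
bound follows from `∑ x y ≤ (∑ x)(∑ y)` for nonnegative terms. -/
theorem nodeLoss_insert {N : Network V E} {q : ℕ} (hq : 1 ≤ q) {D : ι → Finset E}
    {last : ι → V} {S : Finset E} {e : E} (he : e ∉ S) :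
    1 - N.nodeLoss q D last S (N.tail e) ≤
      (1 - ∑ i with e ∈ D i ∧ last i ≠ N.tail e,
        1 / (q : ℝ) ^ N.remaining (D i) S (N.tail e)) *
      (1 - N.nodeLoss q D last (insert e S) (N.tail e)) := by
  set x : ι → ℝ := fun i =>
    if e ∈ D i then 1 / (q : ℝ) ^ N.remaining (D i) S (N.tail e) else 0 with hx
  set y : ι → ℝ := fun i => 1 - invertibleProb q (N.remaining (D i) (insert e S) (N.tail e))
    with hy
  have hx0 : ∀ i, 0 ≤ x i := fun i => by
    simp only [hx]; split_ifs <;> positivity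
  have hy0 : ∀ i, 0 ≤ y i := fun i => by
    simp only [hy]; linarith [invertibleProb_le_one hq (N.remaining (D i) (insert e S) (N.tail e))]
  have h1 : N.nodeLoss q D last S (N.tail e) =
      ∑ i with last i ≠ N.tail e, (x i + y i - x i * y i) := by
    refine Finset.sum_congr rfl fun i _ => ?_
    simp only [hx, hy]
    split_ifs with h
    · rw [← remaining_insert he h, invertibleProb_succ]
      ring
    · rw [remaining_insert_of_ne fun h' => absurd h' h]
      ring
  have h2 : ∑ i with e ∈ D i ∧ last i ≠ N.tail e,
      1 / (q : ℝ) ^ N.remaining (D i) S (N.tail e) = ∑ i with last i ≠ N.tail e, x i := by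
    simp only [hx, ← Finset.sum_filter, Finset.filter_filter]
    congr 1
    ext i; simp [and_comm]
  have h3 : N.nodeLoss q D last (insert e S) (N.tail e) = ∑ i with last i ≠ N.tail e, y i := rfl
  rw [h1, h2, h3, Finset.sum_sub_distrib, Finset.sum_add_distrib]
  have h4 : ∑ i with last i ≠ N.tail e, x i * y i ≤
      (∑ i with last i ≠ N.tail e, x i) * ∑ i with last i ≠ N.tail e, y i := by
    rw [Finset.sum_mul]
    exact Finset.sum_le_sum fun i hi => mul_le_mul_of_nonneg_left
      (Finset.single_le_sum (fun j _ => hy0 j) hi) (hx0 i)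
  linarith

/-- Only factors at the tail of `e` change. The factors at other nodes must be nonnegative to be
multiplied back in, which is the role of `hloss`. -/
theorem potential_le_insert [Fintype V] {N : Network V E} {q : ℕ} (hq : 1 ≤ q)
    {D : ι → Finset E} {last : ι → V} (hloss : ∀ S v, N.nodeLoss q D last S v ≤ 1)
    {S : Finset E} {e : E} (he : e ∉ S) :
    N.potential q D last S ≤
      (∏ i with e ∈ D i ∧ last i = N.tail e,
        (1 - 1 / (q : ℝ) ^ N.remaining (D i) S (N.tail e))) *
      (1 - ∑ i with e ∈ D i ∧ last i ≠ N.tail e,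
        1 / (q : ℝ) ^ N.remaining (D i) S (N.tail e)) *
      N.potential q D last (insert e S) := by
  have h1 : ∏ i, invertibleProb q (N.remaining (D i) S (last i)) =
      (∏ i with e ∈ D i ∧ last i = N.tail e,
        (1 - 1 / (q : ℝ) ^ N.remaining (D i) S (N.tail e))) *
      ∏ i, invertibleProb q (N.remaining (D i) (insert e S) (last i)) := by
    rw [Finset.prod_filter, ← Finset.prod_mul_distrib]
    refine Finset.prod_congr rfl fun i _ => ?_
    split_ifs with h
    · rw [h.2, ← remaining_insert he h.1, invertibleProb_succ, mul_comm]
    · rw [one_mul, remaining_insert_of_ne fun h' h'' => h ⟨h', h''.symm⟩]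
  have h2 : ∏ v, (1 - N.nodeLoss q D last S v) ≤
      (1 - ∑ i with e ∈ D i ∧ last i ≠ N.tail e,
        1 / (q : ℝ) ^ N.remaining (D i) S (N.tail e)) *
      ∏ v, (1 - N.nodeLoss q D last (insert e S) v) := by
    rw [← Finset.mul_prod_erase _ _ (mem_univ (N.tail e)),
      ← Finset.mul_prod_erase _ (fun v => 1 - N.nodeLoss q D last (insert e S) v)
        (mem_univ (N.tail e)), ← mul_assoc]
    have h3 : ∏ v ∈ univ.erase (N.tail e), (1 - N.nodeLoss q D last S v) =
        ∏ v ∈ univ.erase (N.tail e), (1 - N.nodeLoss q D last (insert e S) v) := by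
      refine Finset.prod_congr rfl fun v hv => ?_
      simp only [nodeLoss]
      congr 1
      refine Finset.sum_congr rfl fun i _ => ?_
      rw [remaining_insert_of_ne fun _ => (Finset.ne_of_mem_erase hv).symm]
    rw [h3]
    exact mul_le_mul_of_nonneg_right (nodeLoss_insert hq he)
      (Finset.prod_nonneg fun v _ => sub_nonneg.2 (hloss _ v))
  rw [potential, potential, h1]
  set A := ∏ i with e ∈ D i ∧ last i = N.tail e,
    (1 - 1 / (q : ℝ) ^ N.remaining (D i) S (N.tail e))
  set C := ∏ i, invertibleProb q (N.remaining (D i) (insert e S) (last i))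
  have hA : 0 ≤ A := Finset.prod_nonneg fun i _ =>
    sub_nonneg.2 (one_div_pow_le_one hq _)
  have hC : 0 ≤ C := Finset.prod_nonneg fun i _ => invertibleProb_nonneg hq _
  calc _ ≤ _ := mul_le_mul_of_nonneg_left h2 (mul_nonneg hA hC)
    _ = _ := by ring

theorem potential_nonneg [Fintype V] {N : Network V E} {q : ℕ} (hq : 1 ≤ q)
    {D : ι → Finset E} {last : ι → V} {S : Finset E}
    (hloss : ∀ v, N.nodeLoss q D last S v ≤ 1) : 0 ≤ N.potential q D last S :=
  mul_nonneg (Finset.prod_nonneg fun _ _ => invertibleProb_nonneg hq _)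
    (Finset.prod_nonneg fun v _ => sub_nonneg.2 (hloss v))

theorem potential_univ [Fintype V] [Fintype E] (N : Network V E) (q : ℕ) (D : ι → Finset E)
    (last : ι → V) : N.potential q D last univ = 1 := by
  have h : ∀ i v, N.remaining (D i) univ v = 0 := fun i v => by
    simp [remaining, sdiff_eq_empty_iff_subset.2 (subset_univ (D i))]
  simp [potential, nodeLoss, h, invertibleProb_zero]

theorem remaining_le_remaining_empty (N : Network V E) (D S : Finset E) (v : V) :
    N.remaining D S v ≤ N.remaining D ∅ v :=
  card_le_card (filter_subset_filter _ (sdiff_subset_sdiff subset_rfl (empty_subset S)))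

theorem nodeLoss_le {N : Network V E} {q w : ℕ} (hq : 1 ≤ q) {D : ι → Finset E} {last : ι → V}
    (hD : ∀ i v, N.remaining (D i) ∅ v ≤ w) (S : Finset E) (v : V) :
    N.nodeLoss q D last S v ≤
      (#{i | v ∈ ((D i).image N.tail).erase (last i)} : ℕ) * (1 - invertibleProb q w) := by
  have h : ∀ i, 1 - invertibleProb q (N.remaining (D i) S v) ≤
      if v ∈ (D i).image N.tail then 1 - invertibleProb q w else 0 := by
    intro i
    have hle := N.remaining_le_remaining_empty (D i) S v
    split_ifs with hv
    · linarith [invertibleProb_antitone hq (hle.trans (hD i v))]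
    · have h0 : N.remaining (D i) ∅ v = 0 := by
        rw [remaining, card_eq_zero, filter_eq_empty_iff]
        intro e he hev
        rw [sdiff_empty] at he
        exact hv (mem_image.2 ⟨e, he, hev⟩)
      rw [Nat.eq_zero_of_le_zero (hle.trans h0.le), invertibleProb_zero, sub_self]
  calc N.nodeLoss q D last S v ≤
        ∑ i with last i ≠ v, if v ∈ (D i).image N.tail then 1 - invertibleProb q w else 0 :=
        Finset.sum_le_sum fun i _ => h i
    _ = _ := by
        rw [← Finset.sum_filter, Finset.filter_filter, Finset.sum_const, nsmul_eq_mul]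
        congr 3
        ext i; simp [eq_comm]

end Potential

/-! ### Counting the successful coefficient choices. -/

section Probability

variable {V E F ι : Type*} [DecidableEq V] [Fintype E] [DecidableEq E] [Field F]
  [Finite F] [Fintype ι]

/-- Processing one more channel keeps all sinks decodable with a definite probability. -/
theorem mul_card_decodable_le {N : Network V E} {w : ℕ} {τ : ι → V} (hτ : τ.Injective)
    {D : ι → Finset E} {last : ι → V} (hDτ : ∀ i, ∀ e ∈ D i, N.tail e ≠ τ i)
    (hlast : ∀ i, ∀ e ∈ D i, N.tail e = last i → N.head e = τ i)
    {S : Finset E} {e : E} (hS : ∀ d ∈ S, ∀ c, N.Feeds c d → c ∈ S) (he : e ∉ S)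
    (hpred : ∀ c, N.Feeds c e → c ∈ S) :
    (∏ i with e ∈ D i ∧ last i = N.tail e,
        (1 - 1 / (Nat.card F : ℝ) ^ N.remaining (D i) S (N.tail e))) *
      (1 - ∑ i with e ∈ D i ∧ last i ≠ N.tail e,
        1 / (Nat.card F : ℝ) ^ N.remaining (D i) S (N.tail e)) *
      Nat.card {k : N.LocalCoeffs w F // ∀ i, N.Decodable w k (τ i) (D i) S} ≤
    Nat.card {k : N.LocalCoeffs w F // ∀ i, N.Decodable w k (τ i) (D i) (insert e S)} := by
  refine mul_card_le_card_of_update _ _ e _ fun k hk => ?_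
  have hB : ∀ i, ∃ B : Submodule F (N.ExtIn w (N.tail e) → F), e ∈ D i →
      Nat.card B * Nat.card F ^ N.remaining (D i) S (N.tail e) =
        Nat.card (N.ExtIn w (N.tail e) → F) ∧
      ∀ y, y ∉ B → N.Decodable w (Function.update k e y) (τ i) (D i) (insert e S) := by
    intro i
    by_cases heD : e ∈ D i
    · obtain ⟨B, h⟩ := (hk i).exists_submodule hS he hpred heD (hDτ i e heD)
      exact ⟨B, fun _ => h⟩
    · exact ⟨⊥, fun h => absurd h heD⟩
  choose B hB using hB
  have hfrac : ∀ i, e ∈ D i → 1 / (Nat.card F : ℝ) ^ N.remaining (D i) S (N.tail e) =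
      (Nat.card (B i) : ℝ) / Nat.card (N.ExtIn w (N.tail e) → F) := by
    intro i hi
    have hF : (0 : ℝ) < Nat.card F := by exact_mod_cast Nat.card_pos
    have hBi : (0 : ℝ) < Nat.card (B i) := by exact_mod_cast Nat.card_pos
    rw [← (hB i hi).1]
    push_cast
    field_simp
  -- Such a sink is the head of `e`, and distinct indices have distinct sinks.
  have hs : #{i | e ∈ D i ∧ last i = N.tail e} ≤ 1 := by
    refine Finset.card_le_one.2 fun i hi j hj => hτ ?_
    simp only [mem_filter, mem_univ, true_and] at hi hj
    rw [← hlast i e hi.1 hi.2.symm, hlast j e hj.1 hj.2.symm]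
  have h1 : ∏ i with e ∈ D i ∧ last i = N.tail e,
      (1 - 1 / (Nat.card F : ℝ) ^ N.remaining (D i) S (N.tail e)) =
      ∏ i with e ∈ D i ∧ last i = N.tail e,
        (1 - (Nat.card (B i) : ℝ) / Nat.card (N.ExtIn w (N.tail e) → F)) :=
    Finset.prod_congr rfl fun i hi => by rw [hfrac i (mem_filter.1 hi).2.1]
  have h2 : ∑ i with e ∈ D i ∧ last i ≠ N.tail e,
      1 / (Nat.card F : ℝ) ^ N.remaining (D i) S (N.tail e) =
      ∑ i with e ∈ D i ∧ last i ≠ N.tail e,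
        (Nat.card (B i) : ℝ) / Nat.card (N.ExtIn w (N.tail e) → F) :=
    Finset.sum_congr rfl fun i hi => hfrac i (mem_filter.1 hi).2.1
  rw [h1, h2]
  refine (Submodule.le_card_avoiding B _ _ hs).trans ?_
  refine Nat.cast_le.2 (Nat.card_le_card_of_injective (Subtype.map id ?_)
    (Subtype.map_injective _ Function.injective_id))
  rintro y ⟨hy1, hy2⟩ i
  by_cases heD : e ∈ D i
  · refine (hB i heD).2 y ?_
    by_cases hl : last i = N.tail e
    · exact hy1 i (by simp [heD, hl])
    · exact hy2 i (by simp [heD, hl])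
  · exact (hk i).of_notMem hS he heD y

/-- The number of successful choices times the potential does not decrease along a topological
order. Every choice succeeds at the start, and the potential is `1` at the end. -/
theorem potential_mul_card_le [Fintype V] {N : Network V E} {w : ℕ} {τ : ι → V} (hτ : τ.Injective)
    {D : ι → Finset E} {last : ι → V} (hDτ : ∀ i, ∀ e ∈ D i, N.tail e ≠ τ i)
    (hlast : ∀ i, ∀ e ∈ D i, N.tail e = last i → N.head e = τ i)
    (hloss : ∀ S v, N.nodeLoss (Nat.card F) D last S v ≤ 1)
    (h0 : ∀ (k : N.LocalCoeffs w F) i, N.Decodable w k (τ i) (D i) ∅) :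
    N.potential (Nat.card F) D last ∅ * Nat.card (N.LocalCoeffs w F) ≤
      Nat.card {k : N.LocalCoeffs w F // ∀ i, N.Decodable w k (τ i) (D i) univ} := by
  have hq : 1 ≤ Nat.card F := Nat.card_pos
  have key : ∀ n ≤ Fintype.card E, ∃ S : Finset E, #S = n ∧
      (∀ d ∈ S, ∀ c, N.Feeds c d → c ∈ S) ∧
      N.potential (Nat.card F) D last ∅ * Nat.card (N.LocalCoeffs w F) ≤
        Nat.card {k : N.LocalCoeffs w F // ∀ i, N.Decodable w k (τ i) (D i) S} *
          N.potential (Nat.card F) D last S := by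
    intro n
    induction n with
    | zero =>
      refine fun _ => ⟨∅, rfl, by simp, ?_⟩
      rw [mul_comm]
      refine le_of_eq ?_
      congr 2
      exact Nat.card_congr (Equiv.subtypeUnivEquiv fun k => h0 k).symm
    | succ n ih =>
      intro hn
      obtain ⟨S, hSn, hS, hle⟩ := ih (by omega)
      -- A minimal unprocessed channel has all its predecessors in `S`.
      obtain ⟨e, he, hmin⟩ := N.feeds_wellFounded.has_min {e | e ∉ S} (by
        by_contra hne
        rw [Set.not_nonempty_iff_eq_empty, Set.eq_empty_iff_forall_notMem] at hne
        have : S = univ := by ext d; simpa using hne d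
        rw [this, card_univ] at hSn
        omega)
      have hpred : ∀ c, N.Feeds c e → c ∈ S := fun c hc => by
        by_contra hcS
        exact hmin c hcS hc
      refine ⟨insert e S, by rw [card_insert_of_notMem he, hSn], ?_, hle.trans ?_⟩
      · intro d hd c hc
        rcases mem_insert.1 hd with rfl | hd
        · exact mem_insert_of_mem (hpred c hc)
        · exact mem_insert_of_mem (hS d hd c hc)
      · have h1 := mul_card_decodable_le (F := F) hτ hDτ hlast hS he hpred (w := w)
        have h2 := potential_le_insert hq hloss he
        refine (mul_le_mul_of_nonneg_left h2 (Nat.cast_nonneg _)).trans ?_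
        refine le_trans (le_of_eq ?_)
          (mul_le_mul_of_nonneg_right h1 (potential_nonneg hq (hloss (insert e S))))
        ring
  obtain ⟨S, hSn, -, hle⟩ := key _ le_rfl
  obtain rfl := (card_eq_iff_eq_univ S).1 hSn
  rwa [potential_univ, mul_one] at hle

end Probability

/-! ### Passing to the failure probability and the final estimate. -/

section FailureProb

variable {V E F : Type*} [DecidableEq V] [Fintype E] [Field F] [Finite F]

theorem failureProb_le_one (N : Network V E) (T : Finset V) (w : ℕ) :
    N.failureProb T w F ≤ 1 := by
  refine div_le_one_of_le₀ (Nat.cast_le.2 ?_) (Nat.cast_nonneg _)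
  exact Nat.card_le_card_of_injective _ Subtype.val_injective

theorem failureProb_le_one_sub {N : Network V E} {T : Finset V} {w : ℕ} {p : ℝ}
    {A : N.LocalCoeffs w F → Prop} (hA : ∀ k, A k → ∀ t ∈ T, ¬ (N.decodingMatrix w k t).rank < w)
    (hp : p * Nat.card (N.LocalCoeffs w F) ≤ Nat.card {k // A k}) :
    N.failureProb T w F ≤ 1 - p := by
  classical
  have := Fintype.ofFinite F
  have hpos : (0 : ℝ) < Nat.card (N.LocalCoeffs w F) := by exact_mod_cast Nat.card_pos
  rw [failureProb, div_le_iff₀ hpos]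
  have h : Nat.card {k : N.LocalCoeffs w F // ∃ t ∈ T, (N.decodingMatrix w k t).rank < w} +
      Nat.card {k // A k} ≤ Nat.card (N.LocalCoeffs w F) := by
    simp only [Nat.card_eq_fintype_card, Fintype.card_subtype]
    rw [← Finset.card_union_of_disjoint, ← Finset.card_univ]
    · exact Finset.card_le_card (subset_univ _)
    · rw [Finset.disjoint_filter]
      rintro k - ⟨t, ht, hlt⟩ hk
      exact hA k hk t ht hlt
  have h' : (Nat.card {k : N.LocalCoeffs w F // ∃ t ∈ T, (N.decodingMatrix w k t).rank < w} : ℝ) +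
      Nat.card {k // A k} ≤ Nat.card (N.LocalCoeffs w F) := by exact_mod_cast h
  linarith

end FailureProb

end Network

open Network in
theorem theorem2 {V E F : Type*} [Fintype V] [DecidableEq V] [Fintype E]
    [Field F] [Fintype F]
    (N : Network V E) (T : Finset V) (w : ℕ)
    (P : (t : T) → N.DisjointPaths w t)
    (l b u : ℕ) (hl : l = T.card) (hu : u < l)
    (hr : ∑ t : T, (P t).internalNodes.ncard = l * b + u)
    (a : ℝ) (ha : a = singularProb (Fintype.card F) w)
    (hla : b = 0 ∨ (l : ℝ) * a ≤ 1) :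
    N.failureProb T w F ≤
      1 - (1 - a) ^ l * (1 - (l : ℝ) * a) ^ b * (1 - (u : ℝ) * a) := by
  classical
  have hq : 1 ≤ Nat.card F := Nat.card_pos
  have ha' : a = 1 - invertibleProb (Nat.card F) w := by
    rw [ha, Nat.card_eq_fintype_card]; rfl
  have ha0 : 0 ≤ a := by linarith [invertibleProb_le_one hq w]
  have ha1 : 0 ≤ 1 - a := by linarith [invertibleProb_nonneg hq w]
  rcases Nat.eq_zero_or_pos w with rfl | hw
  · have h0 : a = 0 := by rw [ha', invertibleProb_zero, sub_self]
    refine (failureProb_le_one_sub (A := fun _ => True) (p := 1) (by simp) ?_).trans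
      (by simp [h0])
    rw [one_mul, Nat.card_congr (Equiv.subtypeUnivEquiv fun _ => trivial)]
  -- Here `1 - u * a` is negative, so the claimed bound is at least `1`.
  by_cases hbu : b = 0 ∧ 1 < (u : ℝ) * a
  · refine (N.failureProb_le_one T w).trans ?_
    have := pow_nonneg ha1 l
    rw [hbu.1, pow_zero, mul_one]
    nlinarith [hbu.2]
  choose last hlast_mem hlast using fun t => (P t).exists_last_node hw
  set D : T → Finset E := fun t => (P t).edges with hD
  set c : V → ℕ := fun v => #{t | v ∈ ((D t).image N.tail).erase (last t)} with hc
  have hcl : ∀ v, c v ≤ l := fun v => by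
    rw [hl, ← Fintype.card_coe T]
    exact Finset.card_le_univ _
  have hcsum : ∑ v, c v = l * b + u := by
    rw [← hr, hc]
    simp only [Finset.card_filter]
    rw [Finset.sum_comm]
    refine Finset.sum_congr rfl fun t _ => ?_
    rw [← Finset.card_filter, Finset.filter_mem_eq_inter, Finset.univ_inter]
    -- The tails comprise the internal nodes and the source; erasing the last node makes up for the
    -- source, so the count is again `r_t`.
    have h1 : _ = #((D t).image N.tail) := (P t).ncard_internalNodes_add_one hw
    have h2 : #(((D t).image N.tail).erase (last t)) + 1 = #((D t).image N.tail) :=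
      Finset.card_erase_add_one (hlast_mem t)
    omega
  have hca : ∀ v, (c v : ℝ) * a ≤ 1 := by
    intro v
    rcases hla with hb | hla
    · have h1 : c v ≤ u := by
        have := Finset.single_le_sum (f := c) (fun _ _ => Nat.zero_le _) (mem_univ v)
        rw [hcsum, hb] at this
        simpa using this
      have h2 : (c v : ℝ) ≤ u := by exact_mod_cast h1
      have h3 : (u : ℝ) * a ≤ 1 := by
        by_contra! h
        exact hbu ⟨hb, h⟩
      nlinarith
    · have h2 : (c v : ℝ) ≤ l := by exact_mod_cast hcl v
      nlinarith
  have hprod : (1 - (l : ℝ) * a) ^ b * (1 - (u : ℝ) * a) ≤ ∏ v, (1 - (c v : ℝ) * a) := by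
    by_cases hb : b = 0
    · subst hb
      have hsum : ∑ v, (c v : ℝ) * a = u * a := by
        rw [← Finset.sum_mul, ← Nat.cast_sum, hcsum]
        simp
      have := one_sub_sum_mul_le_prod univ (fun v => (c v : ℝ) * a)
        (fun v _ => by positivity) (by
          rw [hsum]
          by_contra! h
          exact hbu ⟨rfl, h⟩)
      rwa [hsum, ← one_mul (1 - (u : ℝ) * a), ← pow_zero (1 - (l : ℝ) * a)] at this
    · have hl0 : 0 < l := by omega
      have := pow_mul_le_prod_one_sub univ c hl0 ha0 (hla.resolve_left hb) fun v _ => hcl v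
      rwa [hcsum, Nat.mul_add_div hl0, Nat.div_eq_of_lt hu, add_zero, Nat.mul_add_mod,
        Nat.mod_eq_of_lt hu] at this
  have hrem : ∀ t v, N.remaining (D t) ∅ v ≤ w := fun t v => by
    rw [remaining, sdiff_empty]
    exact (P t).card_tail_le v
  have hnode : ∀ S v, N.nodeLoss (Nat.card F) D last S v ≤ c v * a := fun S v => by
    rw [ha']
    exact nodeLoss_le hq hrem S v
  have hpot : (1 - a) ^ l * ((1 - (l : ℝ) * a) ^ b * (1 - (u : ℝ) * a)) ≤
      N.potential (Nat.card F) D last ∅ := by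
    refine (mul_le_mul_of_nonneg_left hprod (pow_nonneg ha1 l)).trans ?_
    refine mul_le_mul ?_ ?_ (Finset.prod_nonneg fun v _ => sub_nonneg.2 (hca v))
      (Finset.prod_nonneg fun t _ => invertibleProb_nonneg hq _)
    · calc (1 - a) ^ l = ∏ _t : T, (1 - a) := by
            rw [Finset.prod_const, Finset.card_univ, Fintype.card_coe, hl]
        _ ≤ _ := Finset.prod_le_prod (fun _ _ => ha1) fun t _ => by
            linarith [invertibleProb_antitone hq (hrem t (last t))]
    · exact Finset.prod_le_prod (fun v _ => sub_nonneg.2 (hca v)) fun v _ => by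
        linarith [hnode ∅ v]
  rw [mul_assoc]
  refine (failureProb_le_one_sub
    (A := fun k : N.LocalCoeffs w F => ∀ t : T, N.Decodable w k t (D t) univ) ?_
    (potential_mul_card_le (last := last) Subtype.val_injective (fun t e he => (P t).tail_ne he)
      hlast (fun S v => (hnode S v).trans (hca v)) fun k t => decodable_empty (P t) k)).trans ?_
  · exact fun k hk t ht => (hk ⟨t, ht⟩).not_rank_lt ((P ⟨t, ht⟩).source_ne hw)
  · linarith
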